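/- All rings are associative with $1$. Let $R$ be a nonzero ring. A *left denominator set* of a ring $A$ is a multiplicative subset $S\subseteq A$ with $1\in S$, $0\notin S$, such that $Sa\cap As\neq\emptyset$ for all $a\in A$, $s\in S$ (left Ore condition), and such that $as=0$ with $a\in A$, $s\in S$ implies $ta=0$ for some $t\in S$. Put $\operatorname{ass}(S)=\{a\in A\mid sa=0\text{ for some }s\in S\}$, an ideal of $A$, and let $S^{-1}A$ be the left localization of $A$ at $S$. Let $\operatorname{max.Den}_l(A)$ be the set of left denominator sets of $A$ that are maximal with respect to inclusion. The ring $A$ is *weakly left localizable* if every non-nilpotent element of $A$ belongs to some left denominator set of $A$. The *left localization radical* of $A$ is $\mathfrak l_A=\bigcap_{S\in\operatorname{max.Den}_l(A)}\operatorname{ass}(S)$. Let $\mathcal C_A$ be the set of (two-sided) non-zero-divisors of $A$. One says that $Q_{l,cl}(A)$ exists if $\mathcal C_A$ is a left denominator set, and then $Q_{l,cl}(A)=\mathcal C_A^{-1}A$ is the classical left quotient ring. Let $S_0(A)$ be the largest left denominator set $S$ of $A$ with $\operatorname{ass}(S)=0$ (it exists for every nonzero ring $A$), and $Q_l(A)=S_0(A)^{-1}A$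 the largest left quotient ring. Finally $\operatorname{rad}(A)$ is the Jacobson radical of $A$ and $\mathcal N_A$ is its nil radical, i.e. the sum of all two-sided nil ideals of $A$. **Theorem.** The following statements are equivalent. 1. The ring $R$ is weakly left localizable and (a) $\mathfrak l_R=0$; (b) $\operatorname{max.Den}_l(R)$ is finite; (c) for every $S\in\operatorname{max.Den}_l(R)$ the ring $S^{-1}R$ is weakly left localizable; (d) for all $S,T\in\operatorname{max.Den}_l(R)$ with $S\neq T$, the ideal $\operatorname{ass}(S)$ is not nil modulo $\operatorname{ass}(T)$, i.e. there is $a\in\operatorname{ass}(S)$ with $a^k\notin\operatorname{ass}(T)$ for all $k\ge 1$. 2. The classical left quotient ring $Q_{l,cl}(R)$ exists, and $Q_{l,cl}(R)\cong\prod_{i=1}^n R_i$ for some $n$ and some local rings $R_1,\dots,R_n$ with $\operatorname{rad}(R_i)=\mathcal N_{R_i}$ for all $i$. 3. The largest left quotient ring $Q_l(R)$ is isomorphic to $\prod_{i=1}^n R_i$ for some $n$ and some local rings $R_1,\dots,R_n$ with $\operatorname{rad}(R_i)=\mathcal N_{R_i}$ for all $i$. -/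

import Mathlib

universe u

namespace WLL

/-- A left denominator set of `R`: a multiplicative submonoid `S` (so `1 ∈ S`) with `0 ∉ S`,
satisfying the left Ore condition `S r ∩ R s ≠ ∅`, and such that `r s = 0` with `s ∈ S` forces
`t r = 0` for some `t ∈ S`. -/
structure IsLeftDenominatorSet {R : Type u} [Ring R] (S : Submonoid R) : Prop where
  zero_notMem : (0 : R) ∉ S
  ore : ∀ r : R, ∀ s ∈ S, ∃ t ∈ S, ∃ a : R, t * r = a * s
  reversible : ∀ r : R, ∀ s ∈ S, r * s = 0 → ∃ t ∈ S, t * r = 0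

/-- `ass(S) = {r ∈ R | s r = 0 for some s ∈ S}`. -/
def ass {R : Type u} [Ring R] (S : Submonoid R) : Set R :=
  {r | ∃ s ∈ S, s * r = 0}

/-- The set of maximal left denominator sets of `R`, ordered by inclusion. -/
def maxDen (R : Type u) [Ring R] : Set (Submonoid R) :=
  {S | Maximal IsLeftDenominatorSet S}

/-- The left localization radical of `R`. -/
def leftLocalizationRadical (R : Type u) [Ring R] : Set R :=
  ⋂ S ∈ maxDen R, ass S

/-- The set of left localizable elements of `R`. -/
def leftLocalizableElements (R : Type u) [Ring R] : Set R :=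
  {r | ∃ S : Submonoid R, IsLeftDenominatorSet S ∧ r ∈ S}

/-- `R` is weakly left localizable: every non-nilpotent element is left localizable. -/
def IsWeaklyLeftLocalizable (R : Type u) [Ring R] : Prop :=
  ∀ r : R, ¬ IsNilpotent r → r ∈ leftLocalizableElements R

theorem IsLeftDenominatorSet.nonempty_oreSet {R : Type u} [Ring R] {S : Submonoid R}
    (hS : IsLeftDenominatorSet S) : Nonempty (OreLocalization.OreSet S) := by
  rw [OreLocalization.nonempty_oreSet_iff]
  refine ⟨fun r₁ r₂ s h => ?_, fun r s => ?_⟩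
  · obtain ⟨t, ht, h0⟩ := hS.reversible (r₁ - r₂) s s.2 (by rw [sub_mul, h, sub_self])
    exact ⟨⟨t, ht⟩, by rwa [mul_sub, sub_eq_zero] at h0⟩
  · obtain ⟨t, ht, a, h⟩ := hS.ore r s s.2
    exact ⟨a, ⟨t, ht⟩, h⟩

/-- Mathlib's Ore data of a left denominator set. -/
@[reducible]
noncomputable def IsLeftDenominatorSet.oreSet {R : Type u} [Ring R] {S : Submonoid R}
    (hS : IsLeftDenominatorSet S) : OreLocalization.OreSet S :=
  hS.nonempty_oreSet.some

/-- The left localization `S⁻¹R` of `R` at a left denominator set `S`. -/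
abbrev LeftLocalization {R : Type u} [Ring R] (S : Submonoid R)
    (hS : IsLeftDenominatorSet S) : Type u :=
  letI := hS.oreSet
  OreLocalization S R

noncomputable instance {R : Type u} [Ring R] (S : Submonoid R) (hS : IsLeftDenominatorSet S) :
    Ring (LeftLocalization S hS) :=
  letI := hS.oreSet
  inferInstanceAs (Ring (OreLocalization S R))

/-- The largest regular left denominator set `S₀(R)`, as the submonoid generated by all left
denominator sets `S` with `ass(S) = 0`; see `isGreatest_largestRegular`. -/
def largestRegular (R : Type u) [Ring R] : Submonoid R :=
  Submonoid.closure {s | ∃ S : Submonoid R, (IsLeftDenominatorSet S ∧ ass S = {0}) ∧ s ∈ S}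

theorem le_nonZeroDivisors_of_ass_eq {R : Type u} [Ring R] {S : Submonoid R}
    (hS : IsLeftDenominatorSet S) (h : ass S = {0}) : S ≤ nonZeroDivisors R := by
  have key : ∀ r : R, r ∈ ass S → r = 0 := fun r hr => by simpa [h] using hr
  intro s hs
  refine ⟨fun r hr => key r ⟨s, hs, hr⟩, fun r hr => key r ?_⟩
  exact hS.reversible r s hs hr

theorem largestRegular_le_nonZeroDivisors (R : Type u) [Ring R] :
    largestRegular R ≤ nonZeroDivisors R :=
  (Submonoid.closure_le).2 fun _ ⟨_, hS, hs⟩ => le_nonZeroDivisors_of_ass_eq hS.1 hS.2 hs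

theorem isLeftDenominatorSet_largestRegular (R : Type u) [Ring R] [Nontrivial R] :
    IsLeftDenominatorSet (largestRegular R) where
  zero_notMem h := by
    simpa using (largestRegular_le_nonZeroDivisors R h).1 1 (by simp)
  ore := by
    suffices H : ∀ s ∈ largestRegular R, ∀ r : R, ∃ t ∈ largestRegular R, ∃ a : R,
        t * r = a * s from fun r s hs => H s hs r
    intro s hs
    induction hs using Submonoid.closure_induction with
    | mem s hs' =>
      intro r
      obtain ⟨S, hS, hsS⟩ := hs'
      obtain ⟨t, ht, a, h⟩ := hS.1.ore r s hsS
      exact ⟨t, Submonoid.subset_closure ⟨S, hS, ht⟩, a, h⟩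
    | one => exact fun r => ⟨1, one_mem _, r, by simp⟩
    | mul x y hx hy ihx ihy =>
      intro r
      obtain ⟨t₁, ht₁, a₁, h₁⟩ := ihy r
      obtain ⟨t₂, ht₂, a₂, h₂⟩ := ihx a₁
      exact ⟨t₂ * t₁, mul_mem ht₂ ht₁, a₂, by rw [mul_assoc, h₁, ← mul_assoc, h₂, mul_assoc]⟩
  reversible r s hs h :=
    ⟨1, one_mem _, by
      rw [(largestRegular_le_nonZeroDivisors R hs).2 r h, mul_zero]⟩

theorem isGreatest_largestRegular (R : Type u) [Ring R] [Nontrivial R] :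
    IsGreatest {S : Submonoid R | IsLeftDenominatorSet S ∧ ass S = {0}} (largestRegular R) := by
  refine ⟨⟨isLeftDenominatorSet_largestRegular R, ?_⟩, fun S hS s hs =>
    Submonoid.subset_closure ⟨S, hS, hs⟩⟩
  ext r
  constructor
  · rintro ⟨s, hs, h⟩
    exact (largestRegular_le_nonZeroDivisors R hs).1 r h
  · rintro rfl
    exact ⟨1, one_mem _, mul_zero 1⟩

/-- The largest left quotient ring `Q_l(R) = S₀(R)⁻¹R`. -/
abbrev LargestLeftQuotientRing (R : Type u) [Ring R] [Nontrivial R] : Type u :=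
  LeftLocalization (largestRegular R) (isLeftDenominatorSet_largestRegular R)

/-- The nil radical of `R`: the sum of all two-sided nil ideals. -/
def nilRadical (R : Type u) [Ring R] : Ideal R :=
  sSup {I | I.IsTwoSided ∧ ∀ x ∈ I, IsNilpotent x}

/-- `Q` is isomorphic to a finite direct product of local rings `L i` whose Jacobson radical
equals their nil radical. -/
def IsFiniteProductOfLocalNil (Q : Type u) [Ring Q] : Prop :=
  ∃ (n : ℕ) (L : Fin n → Type u) (_ : ∀ i, Ring (L i)),
    (∀ i, IsLocalRing (L i) ∧ Ring.jacobson (L i) = nilRadical (L i)) ∧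
      Nonempty (Q ≃+* ∀ i, L i)

end WLL

/-! A local ring whose Jacobson radical is nil is the same as a nontrivial ring in which every
element is a unit or nilpotent. All three conditions say that `R` is a left order in a finite
product of such rings (`IsLeftOrderInProduct`).

Given such an order, an element of `R` is regular iff all its components are units, so the product
is the classical quotient ring. The maximal left denominator sets are the preimages of the units of
the factors: a multiplicative set inside none of them contains, for each factor, an element
vanishing there, and the product of these elements is `0`.

Conversely, a denominator set in the localization at a maximal `S` consists of units, since
otherwise `S` could be enlarged. Weak localizability of `S⁻¹R` thus makes each of its elements a
unit or nilpotent. Zero radical and finiteness embed `R` in the product of these localizations.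
Condition (d) yields elements invertible in one factor and zero in the others, and these glue
fractions chosen factor by factor. -/

namespace WLL

open OreLocalization

/-! ### Rings all of whose elements are units or nilpotent -/

/-- A nontrivial ring in which every element is a unit or nilpotent. -/
def IsUnitOrNilpotentRing (A : Type*) [Ring A] : Prop :=
  Nontrivial A ∧ ∀ a : A, IsUnit a ∨ IsNilpotent a

theorem isNilpotent_of_mem_sup {A : Type*} [Ring A] {I J : Ideal A} [I.IsTwoSided]
    (hI : ∀ x ∈ I, IsNilpotent x) (hJ : ∀ x ∈ J, IsNilpotent x) {x : A} (hx : x ∈ I ⊔ J) :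
    IsNilpotent x := by
  obtain ⟨i, hi, j, hj, rfl⟩ := Submodule.mem_sup.1 hx
  obtain ⟨n, hn⟩ := hJ j hj
  have h : (i + j) ^ n ∈ I := by
    rw [← Ideal.Quotient.eq_zero_iff_mem, map_pow, map_add, Ideal.Quotient.eq_zero_iff_mem.2 hi,
      zero_add, ← map_pow, hn, map_zero]
  obtain ⟨m, hm⟩ := hI _ h
  exact ⟨n * m, by rw [pow_mul, hm]⟩

theorem isNilpotent_of_mem_nilRadical {A : Type u} [Ring A] {x : A} (hx : x ∈ nilRadical A) :
    IsNilpotent x := by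
  rw [nilRadical, Submodule.mem_sSup_of_directed] at hx
  · obtain ⟨I, hI, hxI⟩ := hx
    exact hI.2 x hxI
  · exact ⟨⊥, inferInstance, by simp⟩
  · rintro I ⟨hI, hI'⟩ J ⟨hJ, hJ'⟩
    refine ⟨I ⊔ J, ⟨⟨fun b hx => ?_⟩, fun x hx => isNilpotent_of_mem_sup hI' hJ' hx⟩,
      le_sup_left, le_sup_right⟩
    obtain ⟨i, hi, j, hj, rfl⟩ := Submodule.mem_sup.1 hx
    rw [add_mul]
    exact Submodule.add_mem_sup (Ideal.mul_mem_right b I hi) (Ideal.mul_mem_right b J hj)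

theorem mem_ringJacobson_iff {A : Type*} [Ring A] {x : A} :
    x ∈ Ring.jacobson A ↔ ∀ y, ∃ z, z * y * x + z = 1 := by
  rw [← Ideal.jacobson_bot, Ideal.mem_jacobson_iff]
  simp only [Ideal.mem_bot, sub_eq_zero]

theorem nilRadical_le_jacobson (A : Type u) [Ring A] : nilRadical A ≤ Ring.jacobson A := by
  refine sSup_le fun I hI x hx => mem_ringJacobson_iff.2 fun y => ?_
  obtain ⟨u, hu⟩ := (hI.2 (y * x) (I.mul_mem_left y hx)).isUnit_add_one
  refine ⟨↑u⁻¹, ?_⟩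
  rw [mul_assoc, ← mul_add_one, ← hu, Units.inv_mul]

/-- The element `a * y` is idempotent. If it is a unit, it is `1`; if `1 - a * y` is a unit, then
`(1 - a * y) * a = 0` forces `a = 0`. -/
theorem isUnit_of_mul_eq_one_of_isLocalRing {A : Type*} [Ring A] [IsLocalRing A] {a y : A}
    (h : y * a = 1) : IsUnit a := by
  rcases IsLocalRing.isUnit_or_isUnit_of_add_one (add_sub_cancel (a * y) 1) with hu | hu
  · have hi : a * y * (a * y) = a * y * 1 := by rw [mul_assoc, ← mul_assoc y, h, one_mul, mul_one]
    exact ⟨⟨a, y, hu.mul_left_cancel hi, h⟩, rfl⟩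
  · have h0 : a = 0 := hu.mul_left_cancel (by
      rw [sub_mul, mul_assoc, h, one_mul, mul_one, sub_self, mul_zero])
    rw [h0, mul_zero] at h
    exact absurd h zero_ne_one

theorem mem_jacobson_of_not_isUnit {A : Type*} [Ring A] [IsLocalRing A] {a : A}
    (ha : ¬ IsUnit a) : a ∈ Ring.jacobson A := by
  refine mem_ringJacobson_iff.2 fun y => ?_
  have h1 : -(y * a) + (y * a + 1) = 1 := by abel
  rcases IsLocalRing.isUnit_or_isUnit_of_add_one h1 with hu | hu
  · obtain ⟨v, hv⟩ := hu.neg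
    refine absurd (isUnit_of_mul_eq_one_of_isLocalRing (y := ↑v⁻¹ * y) ?_) ha
    rw [mul_assoc, ← neg_neg (y * a), ← hv, Units.inv_mul]
  · obtain ⟨v, hv⟩ := hu
    exact ⟨↑v⁻¹, by rw [mul_assoc, ← mul_add_one, ← hv, Units.inv_mul]⟩

theorem isUnitOrNilpotentRing_iff {A : Type u} [Ring A] :
    IsUnitOrNilpotentRing A ↔ IsLocalRing A ∧ Ring.jacobson A = nilRadical A := by
  constructor
  · rintro ⟨hA, h⟩
    refine ⟨⟨fun {a b} hab => (h a).imp_right fun ha => ?_⟩, le_antisymm ?_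
      (nilRadical_le_jacobson A)⟩
    · rw [← eq_sub_iff_add_eq'] at hab
      exact hab ▸ ha.isUnit_one_sub
    · refine le_sSup ⟨inferInstance, fun x hx => (h x).resolve_left fun hu => ?_⟩
      exact (Ring.jacobson_lt_top A).ne (Ideal.eq_top_of_isUnit_mem _ hx hu)
  · rintro ⟨hA, h⟩
    exact ⟨inferInstance, fun a => or_iff_not_imp_left.2 fun ha =>
      isNilpotent_of_mem_nilRadical (h ▸ mem_jacobson_of_not_isUnit ha)⟩

theorem IsUnitOrNilpotentRing.isWeaklyLeftLocalizable {A : Type u} [Ring A]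
    (h : IsUnitOrNilpotentRing A) : IsWeaklyLeftLocalizable A := by
  have := h.1
  refine fun a ha => ⟨IsUnit.submonoid A, ⟨not_isUnit_zero, ?_, ?_⟩, (h.2 a).resolve_right ha⟩
  · rintro r _ ⟨s, rfl⟩
    exact ⟨1, one_mem _, r * ↑s⁻¹, by simp⟩
  · rintro r _ ⟨s, rfl⟩ hrs
    exact ⟨1, one_mem _, by simpa using hrs⟩

theorem IsUnitOrNilpotentRing.exists_mul_eq_zero {A : Type*} [Ring A]
    (h : IsUnitOrNilpotentRing A) {a : A} (ha : ¬ IsUnit a) : ∃ b, b ≠ 0 ∧ b * a = 0 := by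
  have := h.1
  have hn := (h.2 a).resolve_left ha
  -- The last nonzero power of `a`; for `a = 0` this is `1`.
  exact ⟨a ^ (nilpotencyClass a - 1), pow_pred_nilpotencyClass hn, by
    rw [← pow_succ, Nat.sub_add_cancel (pos_nilpotencyClass_iff.2 hn), pow_nilpotencyClass hn]⟩

/-! ### Recognizing left localizations -/

/-- Every element of `B` is a left fraction `(f u)⁻¹ (f r)` with `f u` a unit, and every element
of the kernel of `f` is annihilated from the left by such a `u`. -/
structure IsLeftFractionMap {R B : Type*} [Ring R] [Ring B] (f : R →+* B) : Prop where
  surj : ∀ b : B, ∃ u r, IsUnit (f u) ∧ f u * b = f r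
  ker : ∀ r, f r = 0 → ∃ u, IsUnit (f u) ∧ u * r = 0

/-- The elements which `f` maps to units. -/
def unitPreimage {R B : Type*} [Ring R] [Ring B] (f : R →+* B) : Submonoid R :=
  (IsUnit.submonoid B).comap f

@[simp]
theorem mem_unitPreimage {R B : Type*} [Ring R] [Ring B] {f : R →+* B} {r : R} :
    r ∈ unitPreimage f ↔ IsUnit (f r) :=
  Iff.rfl

namespace IsLeftFractionMap

theorem isLeftDenominatorSet {R : Type u} {B : Type*} [Ring R] [Ring B] [Nontrivial B]
    {f : R →+* B} (hf : IsLeftFractionMap f) : IsLeftDenominatorSet (unitPreimage f) where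
  zero_notMem h := by simp at h
  ore r s hs := by
    obtain ⟨v, hv⟩ := mem_unitPreimage.1 hs
    -- Rewriting the right fraction `f r * (f s)⁻¹` as a left fraction gives the Ore identity up to
    -- an element of the kernel, which `w` then kills.
    obtain ⟨u, a, hu, h⟩ := hf.surj (f r * ↑v⁻¹)
    have h0 : f (u * r - a * s) = 0 := by
      rw [map_sub, map_mul, map_mul, ← h, ← hv, mul_assoc, mul_assoc, Units.inv_mul, mul_one,
        sub_self]
    obtain ⟨w, hw, hw0⟩ := hf.ker _ h0
    refine ⟨w * u, (unitPreimage f).mul_mem hw hu, w * a, ?_⟩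
    rw [mul_assoc, mul_assoc, ← sub_eq_zero, ← mul_sub, hw0]
  reversible r s hs h := by
    obtain ⟨v, hv⟩ := mem_unitPreimage.1 hs
    refine hf.ker r ?_
    have := congrArg f h
    rwa [map_mul, map_zero, ← hv, Units.mul_left_eq_zero] at this

theorem mem_ass_iff {R : Type u} {B : Type*} [Ring R] [Ring B] {f : R →+* B}
    (hf : IsLeftFractionMap f) {r : R} : r ∈ ass (unitPreimage f) ↔ f r = 0 := by
  refine ⟨?_, hf.ker r⟩
  rintro ⟨s, ⟨v, hv⟩, h⟩
  have := congrArg f h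
  rwa [map_mul, map_zero, ← hv, Units.mul_right_eq_zero] at this

end IsLeftFractionMap

/-- The canonical homomorphism to the left localization. -/
noncomputable def toLoc {R : Type u} [Ring R] (S : Submonoid R) (hS : IsLeftDenominatorSet S) :
    R →+* LeftLocalization S hS :=
  letI := hS.oreSet
  numeratorRingHom

section toLoc

variable {R : Type u} [Ring R] {S : Submonoid R} (hS : IsLeftDenominatorSet S)

theorem isUnit_toLoc {s : R} (hs : s ∈ S) : IsUnit (toLoc S hS s) :=
  letI := hS.oreSet
  numerator_isUnit (⟨s, hs⟩ : S)

theorem toLoc_surj (q : LeftLocalization S hS) :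
    ∃ s ∈ S, ∃ r, toLoc S hS s * q = toLoc S hS r := by
  let := hS.oreSet
  induction q using OreLocalization.ind with
  | _ r s =>
    refine ⟨s, s.2, r, ?_⟩
    change ((s : R) /ₒ (1 : S)) * (r /ₒ s) = r /ₒ (1 : S)
    exact OreLocalization.mul_cancel

theorem toLoc_eq_zero_iff {r : R} : toLoc S hS r = 0 ↔ r ∈ ass S := by
  let := hS.oreSet
  constructor
  · intro h
    change (r /ₒ (1 : S)) = 0 at h
    rw [OreLocalization.zero_def, oreDiv_eq_iff] at h
    obtain ⟨u, v, h1, h2⟩ := h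
    simp only [smul_zero, OneMemClass.coe_one, mul_one] at h1 h2
    exact ⟨u, u.2, by rw [h2]; exact h1.symm⟩
  · rintro ⟨s, hs, h⟩
    have := congrArg (toLoc S hS) h
    rw [map_mul, map_zero] at this
    exact (isUnit_toLoc hS hs).mul_right_eq_zero.1 this

theorem isLeftFractionMap_toLoc : IsLeftFractionMap (toLoc S hS) where
  surj q := by
    obtain ⟨s, hs, r, h⟩ := toLoc_surj hS q
    exact ⟨s, r, isUnit_toLoc hS hs, h⟩
  ker r h := by
    obtain ⟨s, hs, h0⟩ := (toLoc_eq_zero_iff hS).1 h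
    exact ⟨s, isUnit_toLoc hS hs, h0⟩

theorem nontrivial_leftLocalization : Nontrivial (LeftLocalization S hS) := by
  refine ⟨1, 0, fun h => ?_⟩
  rw [← map_one (toLoc S hS), toLoc_eq_zero_iff] at h
  obtain ⟨s, hs, h⟩ := h
  exact hS.zero_notMem (by rwa [← h, mul_one])

theorem exists_lift_toLoc {B : Type*} [Ring B] (f : R →+* B) (hf : ∀ s ∈ S, IsUnit (f s)) :
    ∃ g : LeftLocalization S hS →+* B, ∀ r, g (toLoc S hS r) = f r := by
  let := hS.oreSet
  exact ⟨universalHom f (IsUnit.liftRight (f.toMonoidHom.comp S.subtype) fun s => hf s s.2)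
    (fun s => rfl), fun r => universalHom_commutes f _ _⟩

end toLoc

/-- The target of a left fraction map is isomorphic to the localization at the preimage
of the units. -/
theorem IsLeftFractionMap.exists_equiv {R : Type u} {B : Type*} [Ring R] [Ring B]
    {f : R →+* B} (hf : IsLeftFractionMap f) (hS : IsLeftDenominatorSet (unitPreimage f)) :
    ∃ g : LeftLocalization (unitPreimage f) hS ≃+* B, ∀ r, g (toLoc _ hS r) = f r := by
  obtain ⟨g, hg⟩ := exists_lift_toLoc hS f fun s hs => hs
  have hinj : Function.Injective g := by
    refine (injective_iff_map_eq_zero g).2 fun q hq => ?_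
    obtain ⟨s, hs, r, h⟩ := toLoc_surj hS q
    have hr : toLoc _ hS r = 0 := by
      rw [toLoc_eq_zero_iff, hf.mem_ass_iff, ← hg, ← h, map_mul, hq, mul_zero]
    rw [hr] at h
    exact (isUnit_toLoc hS hs).mul_right_eq_zero.1 h
  have hsurj : Function.Surjective g := by
    intro b
    obtain ⟨u, r, hu, h⟩ := hf.surj b
    have hu' : IsUnit (toLoc _ hS u) := isUnit_toLoc hS hu
    obtain ⟨v, hv⟩ := hu'
    refine ⟨↑v⁻¹ * toLoc _ hS r, hu.mul_left_cancel ?_⟩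
    rw [h, ← hg u, ← map_mul, ← hv, Units.mul_inv_cancel_left, hg]
  exact ⟨RingEquiv.ofBijective g ⟨hinj, hsurj⟩, hg⟩

/-! ### Localizations at maximal left denominator sets -/

/-- Left fraction maps compose when the second one is a left localization of the first one. -/
theorem isLeftFractionMap_comp {R : Type u} [Ring R] {S : Submonoid R}
    (hS : IsLeftDenominatorSet S) {T : Submonoid (LeftLocalization S hS)}
    (hT : IsLeftDenominatorSet T) :
    IsLeftFractionMap ((toLoc T hT).comp (toLoc S hS)) := by
  have key : ∀ t ∈ T, ∃ s ∈ S, ∃ r, toLoc S hS s * t = toLoc S hS r ∧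
      IsUnit (toLoc T hT (toLoc S hS r)) := by
    intro t ht
    obtain ⟨s, hs, r, h⟩ := toLoc_surj hS t
    refine ⟨s, hs, r, h, ?_⟩
    rw [← h, map_mul]
    exact ((isUnit_toLoc hS hs).map (toLoc T hT)).mul (isUnit_toLoc hT ht)
  constructor
  · intro b
    obtain ⟨t, ht, a, h⟩ := toLoc_surj hT b
    obtain ⟨s, hs, r, hr, hu⟩ := key t ht
    obtain ⟨s', hs', r', hr'⟩ := toLoc_surj hS (toLoc S hS s * a)
    refine ⟨s' * r, r', ?_, ?_⟩
    · rw [map_mul]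
      exact ((isUnit_toLoc hS hs').map (toLoc T hT)).mul hu
    · simp only [RingHom.comp_apply]
      rw [← hr', map_mul, ← hr, map_mul, map_mul, map_mul, map_mul, ← h]
      simp only [mul_assoc]
  · intro r hr
    obtain ⟨t, ht, h⟩ := (toLoc_eq_zero_iff hT).1 hr
    obtain ⟨s, hs, r', hr', hu⟩ := key t ht
    have h0 : toLoc S hS (r' * r) = 0 := by
      rw [map_mul, ← hr', mul_assoc, h, mul_zero]
    obtain ⟨s', hs', h'⟩ := (toLoc_eq_zero_iff hS).1 h0
    refine ⟨s' * r', ?_, by rw [mul_assoc, h']⟩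
    rw [map_mul]
    exact ((isUnit_toLoc hS hs').map (toLoc T hT)).mul hu

/-- Localizing again at `T` gives a left fraction map from `R` whose unit preimage contains `S`,
hence equals `S` by maximality. The numerator of `t` therefore lies in `S`. -/
theorem isUnit_of_mem_isLeftDenominatorSet {R : Type u} [Ring R] {S : Submonoid R}
    (hS : S ∈ maxDen R) {T : Submonoid (LeftLocalization S hS.prop)}
    (hT : IsLeftDenominatorSet T) {t : LeftLocalization S hS.prop} (ht : t ∈ T) : IsUnit t := by
  have := nontrivial_leftLocalization hT
  have hf := isLeftFractionMap_comp hS.prop hT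
  have heq : S = _ := hS.eq_of_le hf.isLeftDenominatorSet
    fun s hs => (isUnit_toLoc hS.prop hs).map (toLoc T hT)
  obtain ⟨s, hs, r, h⟩ := toLoc_surj hS.prop t
  have hr : r ∈ S := by
    rw [heq, mem_unitPreimage, RingHom.comp_apply, ← h, map_mul]
    exact ((isUnit_toLoc hS.prop hs).map _).mul (isUnit_toLoc hT ht)
  obtain ⟨v, hv⟩ := isUnit_toLoc hS.prop hs
  have hu := isUnit_toLoc hS.prop hr
  rw [← h, ← hv] at hu
  exact (Units.isUnit_units_mul v t).1 hu

theorem isUnitOrNilpotentRing_leftLocalization {R : Type u} [Ring R] {S : Submonoid R}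
    (hS : S ∈ maxDen R) (h : IsWeaklyLeftLocalizable (LeftLocalization S hS.prop)) :
    IsUnitOrNilpotentRing (LeftLocalization S hS.prop) := by
  refine ⟨nontrivial_leftLocalization hS.prop, fun a => or_iff_not_imp_right.2 fun ha => ?_⟩
  obtain ⟨T, hT, haT⟩ := h a ha
  exact isUnit_of_mem_isLeftDenominatorSet hS hT haT

/-! ### Embeddings into finite products -/

/-- `R` is a left order in a finite product of rings whose elements are units or nilpotent. -/
def IsLeftOrderInProduct (R : Type u) [Ring R] : Prop :=
  ∃ (n : ℕ) (L : Fin n → Type u) (_ : ∀ i, Ring (L i)) (f : R →+* ∀ i, L i),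
    (∀ i, IsUnitOrNilpotentRing (L i)) ∧ Function.Injective f ∧ IsLeftFractionMap f

theorem exists_mem_pow_eq_zero {M A : Type*} [Monoid M] [Ring A] (T : Submonoid M) (f : M →* A)
    {a : M} (ha : a ∈ T) (h : IsNilpotent (f a)) : ∃ b ∈ T, f b = 0 := by
  obtain ⟨k, hk⟩ := h
  exact ⟨a ^ k, pow_mem ha k, by rw [map_pow, hk]⟩

theorem isLeftOrderInProduct_of_leftLocalization {R : Type u} [Ring R] {S : Submonoid R}
    (hS : IsLeftDenominatorSet S) (h0 : ass S = {0})
    (h : IsFiniteProductOfLocalNil (LeftLocalization S hS)) : IsLeftOrderInProduct R := by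
  obtain ⟨n, L, iL, hL, ⟨e⟩⟩ := h
  have hinj : Function.Injective ((e : LeftLocalization S hS →+* ∀ i, L i).comp (toLoc S hS)) :=
    (injective_iff_map_eq_zero _).2 fun r hr => by
      have h1 : r ∈ ass S := (toLoc_eq_zero_iff hS).1 (e.map_eq_zero_iff.1 hr)
      simpa [h0] using h1
  refine ⟨n, L, iL, (e : LeftLocalization S hS →+* ∀ i, L i).comp (toLoc S hS),
    fun i => isUnitOrNilpotentRing_iff.2 (hL i), hinj, fun b => ?_, fun r hr => ?_⟩
  · obtain ⟨s, hs, r, h⟩ := toLoc_surj hS (e.symm b)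
    refine ⟨s, r, (isUnit_toLoc hS hs).map e, ?_⟩
    simpa using congrArg e h
  · exact ⟨1, by simp, by rw [hinj (hr.trans (map_zero _).symm), mul_zero]⟩

section Product

variable {R : Type u} [Ring R] {n : ℕ} {L : Fin n → Type u} [∀ i, Ring (L i)]
  {f : R →+* ∀ i, L i}

theorem unitPreimage_eq_nonZeroDivisors (hL : ∀ i, IsUnitOrNilpotentRing (L i))
    (hinj : Function.Injective f) (hf : IsLeftFractionMap f) :
    unitPreimage f = nonZeroDivisors R := by
  ext c
  constructor
  · intro hc
    refine ⟨fun r hr => hinj ?_, fun r hr => hinj ?_⟩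
    · rw [map_zero]
      exact (mem_unitPreimage.1 hc).mul_right_eq_zero.1 (by rw [← map_mul, hr, map_zero])
    · rw [map_zero]
      exact (mem_unitPreimage.1 hc).mul_left_eq_zero.1 (by rw [← map_mul, hr, map_zero])
  · intro hc
    refine mem_unitPreimage.2 (Pi.isUnit_iff.2 fun i => ?_)
    by_contra hi
    obtain ⟨b, hb, hb0⟩ := (hL i).exists_mul_eq_zero hi
    -- Clearing the denominator of `b`, placed in coordinate `i`, gives a nonzero `r` with `r * c =
    -- 0`.
    obtain ⟨u, r, hu, h⟩ := hf.surj (Pi.single i b)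
    have hr : f (r * c) = 0 := by
      rw [map_mul, ← h, mul_assoc, ← Pi.single_mul_left, hb0, Pi.single_zero, mul_zero]
    have hr0 : r = 0 := hc.2 r (hinj (hr.trans (map_zero f).symm))
    rw [hr0, map_zero, hu.mul_right_eq_zero, Pi.single_eq_zero_iff] at h
    exact hb h

theorem exists_quotientRing_of_isLeftFractionMap [Nontrivial R]
    (hL : ∀ i, IsUnitOrNilpotentRing (L i))
    (hinj : Function.Injective f) (hf : IsLeftFractionMap f) :
    ∃ h : IsLeftDenominatorSet (nonZeroDivisors R),
      IsFiniteProductOfLocalNil (LeftLocalization (nonZeroDivisors R) h) := by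
  have := hinj.nontrivial
  have hd := hf.isLeftDenominatorSet
  rw [← unitPreimage_eq_nonZeroDivisors hL hinj hf]
  obtain ⟨g, -⟩ := hf.exists_equiv hd
  exact ⟨hd, n, L, inferInstance, fun i => isUnitOrNilpotentRing_iff.1 (hL i), ⟨g⟩⟩

/-- The numerator of the `i`-th central idempotent has this property. -/
theorem exists_apply_isUnit_and_eq_zero (hf : IsLeftFractionMap f) (i : Fin n) :
    ∃ t, IsUnit (f t i) ∧ ∀ j, j ≠ i → f t j = 0 := by
  obtain ⟨u, t, hu, h⟩ := hf.surj (Pi.single i 1)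
  refine ⟨t, ?_, fun j hj => ?_⟩
  · rw [← h, Pi.mul_apply, Pi.single_eq_same, mul_one]
    exact Pi.isUnit_iff.1 hu i
  · rw [← h, Pi.mul_apply, Pi.single_eq_of_ne hj, mul_zero]

theorem isLeftFractionMap_eval (hinj : Function.Injective f) (hf : IsLeftFractionMap f)
    (i : Fin n) : IsLeftFractionMap ((Pi.evalRingHom L i).comp f) := by
  constructor
  · intro b
    obtain ⟨u, r, hu, h⟩ := hf.surj (Pi.single i b)
    refine ⟨u, r, Pi.isUnit_iff.1 hu i, ?_⟩
    simpa using congrFun h i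
  · intro r hr
    obtain ⟨t, ht, ht0⟩ := exists_apply_isUnit_and_eq_zero hf i
    refine ⟨t, ht, hinj (funext fun j => ?_)⟩
    rw [map_mul, map_zero, Pi.mul_apply, Pi.zero_apply]
    rcases eq_or_ne j i with rfl | hj
    · rw [show f r j = 0 from hr, mul_zero]
    · rw [ht0 j hj, zero_mul]

/-- Otherwise, for each `i`, some element of `T` is nilpotent in coordinate `i` and has a power
vanishing there. Multiplying these powers over all `i` puts `0` in `T`. -/
theorem exists_le_unitPreimage_eval (hL : ∀ i, IsUnitOrNilpotentRing (L i))
    (hinj : Function.Injective f) {T : Submonoid R} (hT : (0 : R) ∉ T) :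
    ∃ i, T ≤ unitPreimage ((Pi.evalRingHom L i).comp f) := by
  by_contra! hcon
  have h1 : ∀ i, ∃ b ∈ T, f b i = 0 := by
    intro i
    obtain ⟨a, ha, hai⟩ := SetLike.not_le_iff_exists.1 (hcon i)
    exact exists_mem_pow_eq_zero T (((Pi.evalRingHom L i).comp f : R →+* L i) : R →* L i) ha
      (((hL i).2 _).resolve_left hai)
  have h2 : ∀ s : Finset (Fin n), ∃ b ∈ T, ∀ i ∈ s, f b i = 0 := by
    intro s
    induction s using Finset.induction_on with
    | empty => exact ⟨1, one_mem _, by simp⟩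
    | insert i s _ ih =>
      obtain ⟨b, hb, hb0⟩ := ih
      obtain ⟨c, hc, hc0⟩ := h1 i
      refine ⟨b * c, mul_mem hb hc, fun j hj => ?_⟩
      rw [map_mul, Pi.mul_apply]
      rcases Finset.mem_insert.1 hj with rfl | hj
      · rw [hc0, mul_zero]
      · rw [hb0 j hj, zero_mul]
  obtain ⟨b, hb, hb0⟩ := h2 Finset.univ
  have : b = 0 := hinj (by
    rw [map_zero]
    exact funext fun i => hb0 i (Finset.mem_univ i))
  exact hT (this ▸ hb)

theorem maxDen_eq_range (hL : ∀ i, IsUnitOrNilpotentRing (L i))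
    (hinj : Function.Injective f) (hf : IsLeftFractionMap f) :
    maxDen R = Set.range fun i => unitPreimage ((Pi.evalRingHom L i).comp f) := by
  have hden : ∀ i, IsLeftDenominatorSet (unitPreimage ((Pi.evalRingHom L i).comp f)) := fun i =>
    have := (hL i).1
    (isLeftFractionMap_eval hinj hf i).isLeftDenominatorSet
  ext S
  constructor
  · intro hS
    obtain ⟨i, hi⟩ := exists_le_unitPreimage_eval hL hinj hS.prop.zero_notMem
    exact ⟨i, (hS.eq_of_le (hden i) hi).symm⟩
  · rintro ⟨i, rfl⟩
    refine ⟨hden i, fun T hT hle => ?_⟩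
    obtain ⟨j, hj⟩ := exists_le_unitPreimage_eval hL hinj hT.zero_notMem
    -- This `t` lies in the `i`-th unit preimage and in no other, so the preimages are pairwise
    -- incomparable.
    obtain ⟨t, ht, ht0⟩ := exists_apply_isUnit_and_eq_zero hf i
    have hji : j = i := by
      by_contra hne
      have := (hL j).1
      have hu : IsUnit (f t j) := hj (hle ht)
      rw [ht0 j hne] at hu
      exact not_isUnit_zero hu
    exact hji ▸ hj

theorem isUnitOrNilpotentRing_of_isLeftFractionMap {A : Type*} [Ring A] {g : R →+* A}
    (hA : IsUnitOrNilpotentRing A) (hg : IsLeftFractionMap g)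
    (hS : IsLeftDenominatorSet (unitPreimage g)) :
    IsUnitOrNilpotentRing (LeftLocalization (unitPreimage g) hS) := by
  obtain ⟨e, -⟩ := hg.exists_equiv hS
  refine ⟨nontrivial_leftLocalization hS, fun a => (hA.2 (e a)).imp (fun h => ?_) fun h => ?_⟩
  · simpa using h.map e.symm
  · simpa using h.map e.symm

theorem localizability_of_isLeftFractionMap (hL : ∀ i, IsUnitOrNilpotentRing (L i))
    (hinj : Function.Injective f) (hf : IsLeftFractionMap f) :
    IsWeaklyLeftLocalizable R ∧
      leftLocalizationRadical R = {0} ∧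
      (maxDen R).Finite ∧
      (∀ (S : Submonoid R) (hS : S ∈ maxDen R),
        IsWeaklyLeftLocalizable (LeftLocalization S hS.prop)) ∧
      (∀ S ∈ maxDen R, ∀ T ∈ maxDen R, S ≠ T →
        ¬ ∀ a ∈ ass S, ∃ k : ℕ, a ^ k ∈ ass T) := by
  have hmax := maxDen_eq_range hL hinj hf
  have hev := isLeftFractionMap_eval hinj hf
  refine ⟨fun r hr => ?_, ?_, hmax ▸ Set.finite_range _, fun S hS => ?_, ?_⟩
  · have : ∃ i, ¬ IsNilpotent (f r i) := by
      by_contra! hcon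
      choose k hk using hcon
      refine hr ⟨∑ i, k i, hinj ?_⟩
      rw [map_zero, map_pow]
      exact funext fun i => pow_eq_zero_of_le
        (Finset.single_le_sum (fun j _ => Nat.zero_le (k j)) (Finset.mem_univ i)) (hk i)
    obtain ⟨i, hi⟩ := this
    have hi' : unitPreimage ((Pi.evalRingHom L i).comp f) ∈ maxDen R := hmax ▸ ⟨i, rfl⟩
    exact ⟨_, hi'.prop, ((hL i).2 _).resolve_right hi⟩
  · ext r
    simp only [leftLocalizationRadical, hmax, Set.mem_iInter, Set.forall_mem_range,
      (hev _).mem_ass_iff, Set.mem_singleton_iff]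
    exact ⟨fun h => hinj ((funext h).trans (map_zero f).symm), fun h i => by rw [h, map_zero]⟩
  · obtain ⟨i, rfl⟩ : S ∈ Set.range _ := hmax ▸ hS
    exact (isUnitOrNilpotentRing_of_isLeftFractionMap (hL i) (hev i)
      hS.prop).isWeaklyLeftLocalizable
  · rw [hmax]
    rintro _ ⟨i, rfl⟩ _ ⟨j, rfl⟩ hij hcon
    have hne : i ≠ j := fun h => hij (by rw [h])
    obtain ⟨t, ht, ht0⟩ := exists_apply_isUnit_and_eq_zero hf j
    obtain ⟨k, hk⟩ := hcon t ((hev i).mem_ass_iff.2 (ht0 i hne))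
    rw [(hev j).mem_ass_iff, map_pow] at hk
    have := (hL j).1
    exact (ht.pow k).ne_zero hk

end Product

/-! ### Rings with enough maximal left denominator sets -/

theorem isLeftOrderInProduct_of_maxDen {R : Type u} [Ring R]
    (hrad : leftLocalizationRadical R = {0}) (hfin : (maxDen R).Finite)
    (hloc : ∀ (S : Submonoid R) (hS : S ∈ maxDen R),
      IsWeaklyLeftLocalizable (LeftLocalization S hS.prop))
    (hnil : ∀ S ∈ maxDen R, ∀ T ∈ maxDen R, S ≠ T → ¬ ∀ a ∈ ass S, ∃ k : ℕ, a ^ k ∈ ass T) :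
    IsLeftOrderInProduct R := by
  have := hfin.to_subtype
  obtain ⟨n, ⟨e⟩⟩ := Finite.exists_equiv_fin (maxDen R)
  let S : Fin n → Submonoid R := fun i => (e.symm i).1
  have hS : ∀ i, S i ∈ maxDen R := fun i => (e.symm i).2
  have hSinj : ∀ {i j}, S i = S j → i = j := fun h => e.symm.injective (Subtype.ext h)
  have hL : ∀ i, IsUnitOrNilpotentRing (LeftLocalization (S i) (hS i).prop) := fun i =>
    isUnitOrNilpotentRing_leftLocalization (hS i) (hloc _ (hS i))
  let f : R →+* ∀ i, LeftLocalization (S i) (hS i).prop :=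
    RingHom.pi fun i => toLoc (S i) (hS i).prop
  have hinj : Function.Injective f := by
    refine (injective_iff_map_eq_zero f).2 fun r hr => ?_
    have hr' : r ∈ leftLocalizationRadical R := by
      refine Set.mem_iInter₂.2 fun T hT => ?_
      have := (toLoc_eq_zero_iff (hS (e ⟨T, hT⟩)).prop).1 (congrFun hr (e ⟨T, hT⟩))
      simpa [S] using this
    simpa [hrad] using hr'
  -- An element of `ass (S i)` that is not nil modulo `ass (S j)` has a non-nilpotent image in
  -- factor `j`, hence a unit there.
  have hsep : ∀ j i, i ≠ j → ∃ a, IsUnit (f a j) ∧ f a i = 0 := by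
    intro j i hij
    have := hnil _ (hS i) _ (hS j) fun h => hij (hSinj h)
    push Not at this
    obtain ⟨a, ha, hk⟩ := this
    refine ⟨a, ((hL j).2 _).resolve_right ?_, (toLoc_eq_zero_iff (hS i).prop).2 ha⟩
    rintro ⟨k, h⟩
    exact hk k ((toLoc_eq_zero_iff (hS j).prop).1 (by rw [map_pow]; exact h))
  have hsep' : ∀ j, ∃ t, IsUnit (f t j) ∧ ∀ i, i ≠ j → f t i = 0 := by
    intro j
    have h2 : ∀ s : Finset (Fin n), ∃ t, IsUnit (f t j) ∧ ∀ i ∈ s, i ≠ j → f t i = 0 := by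
      intro s
      induction s using Finset.induction_on with
      | empty => exact ⟨1, by simp, by simp⟩
      | insert i s _ ih =>
        obtain ⟨b, hb, hb0⟩ := ih
        rcases eq_or_ne i j with rfl | hij
        · refine ⟨b, hb, fun k hk hkj => hb0 k ((Finset.mem_insert.1 hk).resolve_left hkj) hkj⟩
        obtain ⟨c, hc, hc0⟩ := hsep j i hij
        refine ⟨b * c, by rw [map_mul]; exact hb.mul hc, fun k hk hkj => ?_⟩
        rw [map_mul, Pi.mul_apply]
        rcases Finset.mem_insert.1 hk with rfl | hk
        · rw [hc0, mul_zero]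
        · rw [hb0 k hk hkj, zero_mul]
    obtain ⟨t, ht, h⟩ := h2 Finset.univ
    exact ⟨t, ht, fun i => h i (Finset.mem_univ i)⟩
  choose t ht ht0 using hsep'
  -- Only the `i`-th term survives in factor `i`, so numerators and denominators can be prescribed
  -- independently in each factor, up to the unit `f (t i) i`.
  have hsum : ∀ (x : Fin n → R) i, f (∑ j, t j * x j) i = f (t i) i * f (x i) i := by
    intro x i
    rw [map_sum, Finset.sum_apply, Finset.sum_eq_single i]
    · rw [map_mul, Pi.mul_apply]
    · intro j _ hj
      rw [map_mul, Pi.mul_apply, ht0 j i hj.symm, zero_mul]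
    · simp
  refine ⟨n, _, _, f, hL, hinj, fun b => ?_, fun r hr => ?_⟩
  · choose s hs r h using fun i => toLoc_surj (hS i).prop (b i)
    refine ⟨∑ j, t j * s j, ∑ j, t j * r j, Pi.isUnit_iff.2 fun i => ?_, funext fun i => ?_⟩
    · rw [hsum]
      exact (ht i).mul (isUnit_toLoc (hS i).prop (hs i))
    · rw [Pi.mul_apply, hsum, hsum, mul_assoc]
      exact congrArg _ (h i)
  · exact ⟨1, by simp, by rw [hinj (hr.trans (map_zero f).symm), mul_zero]⟩

theorem ass_nonZeroDivisors (R : Type u) [Ring R] : ass (nonZeroDivisors R) = {0} := by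
  ext r
  constructor
  · rintro ⟨s, hs, h⟩
    exact hs.1 r h
  · rintro rfl
    exact ⟨1, one_mem _, mul_zero 1⟩

theorem largestRegular_eq_nonZeroDivisors {R : Type u} [Ring R] [Nontrivial R]
    (h : IsLeftDenominatorSet (nonZeroDivisors R)) : largestRegular R = nonZeroDivisors R :=
  le_antisymm (largestRegular_le_nonZeroDivisors R)
    ((isGreatest_largestRegular R).2 ⟨h, ass_nonZeroDivisors R⟩)

end WLL

theorem mainTheorem1 (R : Type u) [Ring R] [Nontrivial R] :
    List.TFAE [
      WLL.IsWeaklyLeftLocalizable R ∧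
        WLL.leftLocalizationRadical R = {0} ∧
        (WLL.maxDen R).Finite ∧
        (∀ (S : Submonoid R) (hS : S ∈ WLL.maxDen R),
          WLL.IsWeaklyLeftLocalizable (WLL.LeftLocalization S hS.prop)) ∧
        (∀ S ∈ WLL.maxDen R, ∀ T ∈ WLL.maxDen R, S ≠ T →
          ¬ ∀ a ∈ WLL.ass S, ∃ k : ℕ, a ^ k ∈ WLL.ass T),
      ∃ h : WLL.IsLeftDenominatorSet (nonZeroDivisors R),
        WLL.IsFiniteProductOfLocalNil (WLL.LeftLocalization (nonZeroDivisors R) h),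
      WLL.IsFiniteProductOfLocalNil (WLL.LargestLeftQuotientRing R)] := by
  tfae_have 1 → 2 := by
    rintro ⟨-, hrad, hfin, hloc, hnil⟩
    obtain ⟨n, L, iL, f, hL, hinj, hf⟩ :=
      WLL.isLeftOrderInProduct_of_maxDen hrad hfin hloc hnil
    exact WLL.exists_quotientRing_of_isLeftFractionMap hL hinj hf
  tfae_have 2 → 3 := by
    rintro ⟨h, hQ⟩
    -- The localization depends on both the submonoid and its proof, so the submonoid is generalized
    -- before the equality is substituted.
    have key : ∀ (S : Submonoid R) (hS : WLL.IsLeftDenominatorSet S), S = nonZeroDivisors R →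
        WLL.IsFiniteProductOfLocalNil (WLL.LeftLocalization S hS) := by
      rintro S hS rfl
      exact hQ
    exact key _ _ (WLL.largestRegular_eq_nonZeroDivisors h)
  tfae_have 3 → 1 := by
    intro h
    obtain ⟨n, L, iL, f, hL, hinj, hf⟩ := WLL.isLeftOrderInProduct_of_leftLocalization _
      (WLL.isGreatest_largestRegular R).1.2 h
    exact WLL.localizability_of_isLeftFractionMap hL hinj hf
  tfae_finish
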